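/- Let $\Bbbk$ be a field and $R=\Bbbk[x_1,\dots,x_n]$. A graded family of ideals is a sequence $\mathfrak a_\bullet=\{\mathfrak a_i\}_{i\ge1}$ with $\mathfrak a_p\mathfrak a_q\subseteq\mathfrak a_{p+q}$ for all $p,q\ge1$ (and $\mathfrak a_0=R$ by convention); its Rees algebra is $\mathcal R(\mathfrak a_\bullet)=\bigoplus_{i\ge0}\mathfrak a_it^i\subseteq R[t]$. For a monomial ideal $I$ let $\mathrm{NP}(I)\subseteq\mathbb R^n$ be the convex hull of the exponents of the monomials in $I$, and for a graded family of monomial ideals let $$\Delta(\mathfrak a_\bullet)=\overline{\bigcup_{m\ge1}\tfrac1m\,\mathrm{NP}(\mathfrak a_m)}$$ be its Newton–Okounkov body. Write $\overline{\mathfrak b_\bullet}=\{\overline{\mathfrak b_i}\}_{i\ge1}$ for the integral closures of the ideals $\mathfrak b_i$, and $$\widehat\rho(\mathfrak a_\bullet,\overline{\mathfrak b_\bullet})=\sup\left\{\tfrac sr \;\middle|\; s,r\ge1,\ \mathfrak a_{st}\not\subseteq\overline{\mathfrak b_{rt}}\text{ for all }t\gg0\right\}.$$ For $\mathcal C\subseteq\mathbb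 R^n$ put $\mathcal C^o=\{\mathbf a\in\mathbb R^n\mid\langle\mathbf a,\mathbf b\rangle\ge1\text{ for all }\mathbf b\in\mathcal C\}$, where $\langle\cdot,\cdot\rangle$ is the dot product. Suprema and infima are taken in $[-\infty,\infty]$, with $\sup\emptyset=-\infty$ and $1/0=\infty$. **Theorem 2.7.** Let $\mathfrak a_\bullet$ and $\mathfrak b_\bullet$ be graded families of monomial ideals in $R$. 1. If $\mathcal R(\mathfrak b_\bullet)$ is Noetherian, then $$\widehat\rho(\mathfrak a_\bullet,\overline{\mathfrak b_\bullet})=\sup\{\lambda>0\mid\lambda\cdot\Delta(\mathfrak a_\bullet)\not\subseteq\Delta(\mathfrak b_\bullet)\}.$$ 2. If the ideals $\mathfrak b_i$, $i\ge1$, are not all zero and $\{\lambda>0\mid\lambda\cdot\Delta(\mathfrak a_\bullet)\not\subseteq\Delta(\mathfrak b_\bullet)\}\neq\emptyset$, then $$\sup\{\lambda>0\mid\lambda\cdot\Delta(\mathfrak a_\bullet)\not\subseteq\Delta(\mathfrak b_\bullet)\}=\frac1{\inf\{\langle\mathbf a,\mathbf b\rangle\mid\mathbf a\in\Delta(\mathfrak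 a_\bullet),\ \mathbf b\in\Delta(\mathfrak b_\bullet)^o\}}.$$ -/

import Mathlib

open scoped Pointwise

namespace GradedResurgence

open Polynomial

section Ideals

universe u

variable {R : Type u} [CommRing R]

/-- `x` satisfies an equation of integral dependence over the ideal `I`:
`x ^ d + c₁ x ^ (d - 1) + ⋯ + c_d = 0` with `d ≥ 1` and `c_i ∈ I ^ i`. -/
def IsIntegralOver (I : Ideal R) (x : R) : Prop :=
  ∃ (d : ℕ) (c : ℕ → R), 0 < d ∧ (∀ i ∈ Finset.Icc 1 d, c i ∈ I ^ i) ∧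
    x ^ d + ∑ i ∈ Finset.Icc 1 d, c i * x ^ (d - i) = 0

/-- Helper fact: `x` is integral over the ideal `I` iff `x t` is integral over the ring `R[It]`.
It is only used to see that the elements integral over `I` form an ideal. -/
theorem isIntegralOver_iff (I : Ideal R) (x : R) :
    IsIntegralOver I x ↔ IsIntegral (reesAlgebra I) (monomial 1 x : R[X]) := by
  constructor
  · rintro ⟨d, c, hd, hc, h⟩
    let e : ℕ → reesAlgebra I := fun i =>
      if hi : i ∈ Finset.Icc 1 d then ⟨monomial i (c i), reesAlgebra.monomial_mem.2 (hc i hi)⟩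
      else 0
    refine ⟨X ^ d + ∑ i ∈ Finset.Icc 1 d, C (e i) * X ^ (d - i), ?_, ?_⟩
    · refine monic_X_pow_add ?_
      refine lt_of_le_of_lt (degree_sum_le _ _) ?_
      rw [Finset.sup_lt_iff (by exact WithBot.bot_lt_coe d)]
      intro i hi
      refine lt_of_le_of_lt (degree_C_mul_X_pow_le _ _) ?_
      rw [Finset.mem_Icc] at hi
      exact_mod_cast (by omega : d - i < d)
    · rw [eval₂_add, eval₂_pow, eval₂_X, eval₂_finsetSum]
      have hterm : ∀ i ∈ Finset.Icc 1 d,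
          eval₂ (algebraMap (reesAlgebra I) R[X]) (monomial 1 x) (C (e i) * X ^ (d - i)) =
            monomial d (c i * x ^ (d - i)) := by
        intro i hi
        have he : algebraMap (reesAlgebra I) R[X] (e i) = monomial i (c i) := by
          simp only [e, dif_pos hi]
          rfl
        rw [eval₂_mul, eval₂_C, eval₂_pow, eval₂_X, he, monomial_pow, monomial_mul_monomial]
        rw [Finset.mem_Icc] at hi
        congr 2
        omega
      rw [Finset.sum_congr rfl hterm, ← map_sum, monomial_pow, one_mul, ← map_add, h, map_zero]
  · rintro ⟨q₀, hq₀, h₀⟩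
    rcases subsingleton_or_nontrivial R with hR | hR
    · exact ⟨1, 0, one_pos, by simp, Subsingleton.elim _ _⟩
    have key : ∃ q : (reesAlgebra I)[X], q.Monic ∧ 0 < q.natDegree ∧
        eval₂ (algebraMap (reesAlgebra I) R[X]) (monomial 1 x) q = 0 := by
      refine ⟨q₀ * X, hq₀.mul monic_X, ?_, ?_⟩
      · rw [hq₀.natDegree_mul monic_X, natDegree_X]; omega
      · rw [eval₂_mul, h₀, zero_mul]
    obtain ⟨q, hq, hd, h⟩ := key
    refine ⟨q.natDegree, fun i => (q.coeff (q.natDegree - i) : R[X]).coeff i, hd, ?_, ?_⟩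
    · intro i _
      exact (q.coeff (q.natDegree - i)).2 i
    · have hlc : q.coeff q.natDegree = 1 := hq
      have h' := congrArg (fun p : R[X] => p.coeff q.natDegree) h
      simp only [eval₂_eq_sum_range, finsetSum_coeff, coeff_zero] at h'
      have hterm : ∀ i ∈ Finset.range (q.natDegree + 1),
          (algebraMap (reesAlgebra I) R[X] (q.coeff i) * (monomial 1 x : R[X]) ^ i).coeff
            q.natDegree = (q.coeff i : R[X]).coeff (q.natDegree - i) * x ^ i := by
        intro i hi
        rw [Finset.mem_range] at hi
        have hi' : q.natDegree = (q.natDegree - i) + i := by omega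
        rw [monomial_pow, one_mul]
        conv_lhs => rw [hi']
        rw [coeff_mul_monomial]
        rfl
      rw [Finset.sum_congr rfl hterm, Finset.sum_range_succ, hlc] at h'
      have hre : ∑ i ∈ Finset.Icc 1 q.natDegree,
          (q.coeff (q.natDegree - i) : R[X]).coeff i * x ^ (q.natDegree - i) =
          ∑ i ∈ Finset.range q.natDegree,
            (q.coeff i : R[X]).coeff (q.natDegree - i) * x ^ i := by
        refine Finset.sum_nbij' (fun i => q.natDegree - i) (fun i => q.natDegree - i)
          ?_ ?_ ?_ ?_ ?_
        · intro i hi; rw [Finset.mem_Icc] at hi; rw [Finset.mem_range]; omega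
        · intro i hi; rw [Finset.mem_range] at hi; rw [Finset.mem_Icc]; omega
        · intro i hi; rw [Finset.mem_Icc] at hi; omega
        · intro i hi; rw [Finset.mem_range] at hi; omega
        · intro i hi
          rw [Finset.mem_Icc] at hi
          have : q.natDegree - (q.natDegree - i) = i := by omega
          rw [this]
      simp only [hre]
      rw [add_comm]
      simpa using h'

/-- The integral closure `Ī` of an ideal `I` of `R`. -/
def idealClosure (I : Ideal R) : Ideal R where
  carrier := {x | IsIntegralOver I x}
  zero_mem' := ⟨1, 0, one_pos, by simp, by simp⟩
  add_mem' {x y} hx hy := by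
    rw [Set.mem_ofPred_eq, isIntegralOver_iff] at *
    rw [map_add]
    exact hx.add hy
  smul_mem' r x hx := by
    rw [Set.mem_ofPred_eq, isIntegralOver_iff] at *
    have h : (monomial 1 (r • x) : R[X]) = algebraMap R R[X] r * monomial 1 x := by
      rw [algebraMap_eq, C_mul_monomial, smul_eq_mul]
    rw [h]
    exact (isIntegral_algebraMap (R := reesAlgebra I)
      (x := algebraMap R (reesAlgebra I) r)).mul hx

/-- A graded family `{a_i}_{i ≥ 1}` of ideals of `R`: `a_p a_q ⊆ a_{p+q}` for all `p, q ≥ 1`.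
The entry of index `0` is `R`, by convention. -/
structure GradedFamily (R : Type u) [CommRing R] where
  ideal : ℕ → Ideal R
  ideal_zero : ideal 0 = ⊤
  mul_le : ∀ p q : ℕ, 1 ≤ p → 1 ≤ q → ideal p * ideal q ≤ ideal (p + q)

theorem GradedFamily.mul_le_add (a : GradedFamily R) (p q : ℕ) :
    a.ideal p * a.ideal q ≤ a.ideal (p + q) := by
  rcases Nat.eq_zero_or_pos p with rfl | hp
  · simp [a.ideal_zero]
  rcases Nat.eq_zero_or_pos q with rfl | hq
  · simp [a.ideal_zero]
  exact a.mul_le p q hp hq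

/-- The Rees algebra `⨁_{i ≥ 0} a_i t^i ⊆ R[t]` of a graded family. -/
def reesAlg (a : GradedFamily R) : Subalgebra R R[X] where
  carrier := {f | ∀ i, f.coeff i ∈ a.ideal i}
  mul_mem' hf hg i := by
    rw [coeff_mul]
    apply Ideal.sum_mem
    rintro ⟨j, l⟩ e
    rw [← Finset.HasAntidiagonal.mem_antidiagonal.mp e]
    exact a.mul_le_add j l (Ideal.mul_mem_mul (hf j) (hg l))
  add_mem' hf hg i := by
    rw [coeff_add]
    exact Ideal.add_mem _ (hf i) (hg i)
  algebraMap_mem' r i := by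
    rw [Polynomial.algebraMap_apply, Algebra.algebraMap_self_apply, coeff_C]
    split_ifs with h
    · subst h
      simp [a.ideal_zero]
    · simp

/-- The asymptotic resurgence `sup {s / r | s, r ≥ 1, a_{st} ⊄ b_{rt} for t ≫ 0}` of two sequences
of ideals, a supremum in `[-∞, ∞]` (so `-∞` for the empty set). -/
noncomputable def asympResurgence (a b : ℕ → Ideal R) : EReal :=
  sSup {x : EReal | ∃ s r : ℕ, 1 ≤ s ∧ 1 ≤ r ∧
    (∀ᶠ t : ℕ in Filter.atTop, ¬ a (s * t) ≤ b (r * t)) ∧ x = (((s : ℝ) / (r : ℝ) : ℝ) : EReal)}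

end Ideals

section Monomial

variable {k : Type*} [Field k] {n : ℕ}

/-- A monomial ideal: an ideal generated by monomials. -/
def IsMonomialIdeal (I : Ideal (MvPolynomial (Fin n) k)) : Prop :=
  ∃ S : Set (Fin n →₀ ℕ), I = Ideal.span ((fun u => MvPolynomial.monomial u (1 : k)) '' S)

/-- The Newton polyhedron: the convex hull in `ℝⁿ` of the exponents of the monomials in `I`. -/
def newtonPolyhedron (I : Ideal (MvPolynomial (Fin n) k)) : Set (Fin n → ℝ) :=
  convexHull ℝ {v | ∃ u : Fin n →₀ ℕ, MvPolynomial.monomial u (1 : k) ∈ I ∧ v = fun i => (u i : ℝ)}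

/-- The Newton–Okounkov body `Δ(a)`: the closure of `⋃_{m ≥ 1} (1/m) NP(a_m)`. -/
def newtonOkounkovBody (a : GradedFamily (MvPolynomial (Fin n) k)) : Set (Fin n → ℝ) :=
  closure (⋃ (m : ℕ) (_ : 1 ≤ m), (1 / (m : ℝ)) • newtonPolyhedron (a.ideal m))

end Monomial

section Convex

variable {n : ℕ}

/-- The (reverse) polar set `{a | ⟨a, b⟩ ≥ 1 for all b ∈ C}`. -/
def polarSet (C : Set (Fin n → ℝ)) : Set (Fin n → ℝ) :=
  {a | ∀ b ∈ C, 1 ≤ a ⬝ᵥ b}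

/-- The set of all real `l > 0` with `l • A ⊄ B`. -/
def noncontainmentScalars (A B : Set (Fin n → ℝ)) : Set ℝ :=
  {l | 0 < l ∧ ¬ l • A ⊆ B}

/-- The infimum of `⟨a, b⟩` over `a ∈ A` and `b ∈ B`, in `[-∞, ∞]`. -/
noncomputable def infDot (A B : Set (Fin n → ℝ)) : EReal :=
  sInf {x : EReal | ∃ a ∈ A, ∃ b ∈ B, x = ((a ⬝ᵥ b : ℝ) : EReal)}

/-- The reciprocal `1 / x` of an extended real, with `1 / 0 = ∞`
(in Mathlib the inverse of `0` is `0`). -/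
noncomputable def extRecip (x : EReal) : EReal :=
  open Classical in if x = 0 then ⊤ else x⁻¹

end Convex

end GradedResurgence

open GradedResurgence

namespace GradedResurgence

open MvPolynomial

section Exponents

variable {k : Type*} [Field k] {n : ℕ}

/-- The exponents of the monomials in an ideal. -/
def exponents (I : Ideal (MvPolynomial (Fin n) k)) : Set (Fin n →₀ ℕ) :=
  {u | monomial u (1 : k) ∈ I}

/-- The real point with the same coordinates as an exponent vector. -/
def toPoint (u : Fin n →₀ ℕ) : Fin n → ℝ := fun i => (u i : ℝ)

theorem toPoint_add (u v : Fin n →₀ ℕ) : toPoint (u + v) = toPoint u + toPoint v := by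
  ext i; simp [toPoint]

theorem toPoint_nsmul (m : ℕ) (u : Fin n →₀ ℕ) : toPoint (m • u) = (m : ℝ) • toPoint u := by
  ext i; simp [toPoint]

theorem add_mem_exponents {I : Ideal (MvPolynomial (Fin n) k)} {u : Fin n →₀ ℕ}
    (hu : u ∈ exponents I) (v : Fin n →₀ ℕ) : u + v ∈ exponents I := by
  have h : monomial (u + v) (1 : k) = monomial v 1 * monomial u 1 := by
    rw [monomial_mul, add_comm, one_mul]
  change monomial (u + v) (1 : k) ∈ I
  rw [h]
  exact I.mul_mem_left _ hu

theorem mem_exponents_of_le {I : Ideal (MvPolynomial (Fin n) k)} {u v : Fin n →₀ ℕ}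
    (hu : u ∈ exponents I) (huv : u ≤ v) : v ∈ exponents I := by
  obtain ⟨w, rfl⟩ := exists_add_of_le huv
  exact add_mem_exponents hu w

theorem add_mem_exponents_mul {I J : Ideal (MvPolynomial (Fin n) k)} {u v : Fin n →₀ ℕ}
    (hu : u ∈ exponents I) (hv : v ∈ exponents J) : u + v ∈ exponents (I * J) := by
  have h : monomial (u + v) (1 : k) = monomial u 1 * monomial v 1 := by
    rw [monomial_mul, one_mul]
  change monomial (u + v) (1 : k) ∈ I * J
  rw [h]
  exact Ideal.mul_mem_mul hu hv

theorem nsmul_mem_exponents_pow {I : Ideal (MvPolynomial (Fin n) k)} {u : Fin n →₀ ℕ}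
    (hu : u ∈ exponents I) (m : ℕ) : m • u ∈ exponents (I ^ m) := by
  have h : monomial (m • u) (1 : k) = monomial u 1 ^ m := by rw [monomial_pow, one_pow]
  change monomial (m • u) (1 : k) ∈ I ^ m
  rw [h]
  exact Ideal.pow_mem_pow hu m

theorem mem_exponents_span {S : Set (Fin n →₀ ℕ)} {u : Fin n →₀ ℕ} :
    u ∈ exponents (Ideal.span ((fun v => monomial v (1 : k)) '' S)) ↔ ∃ s ∈ S, s ≤ u := by
  classical
  have h := mem_ideal_span_monomial_image (x := monomial u (1 : k)) (s := S)
  rw [support_monomial, if_neg one_ne_zero] at h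
  simpa [exponents] using h

theorem IsMonomialIdeal.mem_exponents {I : Ideal (MvPolynomial (Fin n) k)}
    (hI : IsMonomialIdeal I) {f : MvPolynomial (Fin n) k} (hf : f ∈ I) {u : Fin n →₀ ℕ}
    (hu : u ∈ f.support) : u ∈ exponents I := by
  obtain ⟨S, rfl⟩ := hI
  rw [mem_exponents_span]
  exact mem_ideal_span_monomial_image.1 hf u hu

theorem le_of_exponents_subset {I J : Ideal (MvPolynomial (Fin n) k)}
    (hI : IsMonomialIdeal I) (h : exponents I ⊆ exponents J) : I ≤ J := by
  obtain ⟨S, rfl⟩ := hI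
  rw [Ideal.span_le]
  rintro _ ⟨u, hu, rfl⟩
  exact h (Ideal.subset_span ⟨u, hu, rfl⟩)

theorem IsMonomialIdeal.mul_le_span {I J : Ideal (MvPolynomial (Fin n) k)}
    (hI : IsMonomialIdeal I) (hJ : IsMonomialIdeal J) :
    I * J ≤ Ideal.span ((fun u => monomial u (1 : k)) '' (exponents I + exponents J)) := by
  classical
  rw [Ideal.mul_le]
  intro f hf g hg
  rw [mem_ideal_span_monomial_image]
  intro u hu
  obtain ⟨v, hv, w, hw, rfl⟩ := Finset.mem_add.1 (support_mul f g hu)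
  exact ⟨v + w, Set.add_mem_add (hI.mem_exponents hf hv) (hJ.mem_exponents hg hw), le_rfl⟩

theorem IsMonomialIdeal.mul {I J : Ideal (MvPolynomial (Fin n) k)}
    (hI : IsMonomialIdeal I) (hJ : IsMonomialIdeal J) : IsMonomialIdeal (I * J) := by
  refine ⟨exponents I + exponents J, le_antisymm (hI.mul_le_span hJ) ?_⟩
  rw [Ideal.span_le]
  rintro _ ⟨_, ⟨u, hu, v, hv, rfl⟩, rfl⟩
  exact add_mem_exponents_mul hu hv

theorem isMonomialIdeal_top : IsMonomialIdeal (⊤ : Ideal (MvPolynomial (Fin n) k)) := by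
  refine ⟨{0}, ?_⟩
  rw [Set.image_singleton, eq_comm, Ideal.eq_top_iff_one]
  exact Ideal.subset_span rfl

theorem IsMonomialIdeal.pow {I : Ideal (MvPolynomial (Fin n) k)}
    (hI : IsMonomialIdeal I) (m : ℕ) : IsMonomialIdeal (I ^ m) := by
  induction m with
  | zero => rw [pow_zero, Ideal.one_eq_top]; exact isMonomialIdeal_top
  | succ m ih => rw [pow_succ]; exact ih.mul hI

theorem IsMonomialIdeal.exists_add_of_mem_exponents_mul {I J : Ideal (MvPolynomial (Fin n) k)}
    (hI : IsMonomialIdeal I) (hJ : IsMonomialIdeal J) {u : Fin n →₀ ℕ}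
    (hu : u ∈ exponents (I * J)) : ∃ v ∈ exponents I, ∃ w ∈ exponents J, v + w = u := by
  obtain ⟨_, ⟨v, hv, w, hw, rfl⟩, hle⟩ := mem_exponents_span.1 (hI.mul_le_span hJ hu)
  obtain ⟨z, rfl⟩ := exists_add_of_le hle
  exact ⟨v, hv, w + z, add_mem_exponents hw z, (add_assoc v w z).symm⟩

theorem IsMonomialIdeal.exists_finset {I : Ideal (MvPolynomial (Fin n) k)}
    (hI : IsMonomialIdeal I) :
    ∃ G : Finset (Fin n →₀ ℕ), (∀ g ∈ G, g ∈ exponents I) ∧ ∀ u ∈ exponents I, ∃ g ∈ G, g ≤ u := by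
  classical
  obtain ⟨S, rfl⟩ := hI
  obtain ⟨T, hTS, hT⟩ := (Submodule.fg_span_iff_fg_span_finset_subset
    ((fun u => monomial u (1 : k)) '' S)).1 (IsNoetherian.noetherian (Ideal.span _))
  obtain ⟨G, hG, rfl⟩ := Finset.subset_set_image_iff.1 hTS
  refine ⟨G, fun g hg => Ideal.subset_span ⟨g, hG hg, rfl⟩, fun u hu => ?_⟩
  have hu' : u ∈ exponents (Ideal.span ((fun v => monomial v (1 : k)) '' (G : Set _))) := by
    change _ ∈ Submodule.span _ _ at hu ⊢
    rw [hT, Finset.coe_image] at hu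
    exact hu
  exact mem_exponents_span.1 hu'

theorem newtonPolyhedron_eq (I : Ideal (MvPolynomial (Fin n) k)) :
    newtonPolyhedron I = convexHull ℝ (toPoint '' exponents I) := by
  unfold newtonPolyhedron
  congr 1
  ext v
  constructor
  · rintro ⟨u, hu, rfl⟩
    exact ⟨u, hu, rfl⟩
  · rintro ⟨u, hu, rfl⟩
    exact ⟨u, hu, rfl⟩

theorem convex_newtonPolyhedron (I : Ideal (MvPolynomial (Fin n) k)) :
    Convex ℝ (newtonPolyhedron I) := convex_convexHull ℝ _

theorem toPoint_mem_newtonPolyhedron {I : Ideal (MvPolynomial (Fin n) k)} {u : Fin n →₀ ℕ}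
    (hu : u ∈ exponents I) : toPoint u ∈ newtonPolyhedron I :=
  subset_convexHull ℝ _ ⟨u, hu, rfl⟩

theorem smul_newtonPolyhedron_subset {I : Ideal (MvPolynomial (Fin n) k)} {c : ℝ}
    {C : Set (Fin n → ℝ)} (hC : Convex ℝ C) (h : ∀ u ∈ exponents I, c • toPoint u ∈ C) :
    c • newtonPolyhedron I ⊆ C := by
  rw [newtonPolyhedron_eq, ← convexHull_smul]
  refine convexHull_min ?_ hC
  rintro _ ⟨_, ⟨u, hu, rfl⟩, rfl⟩
  exact h u hu

theorem IsMonomialIdeal.toPoint_mem_of_mem_exponents_pow {I : Ideal (MvPolynomial (Fin n) k)}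
    (hI : IsMonomialIdeal I) {m : ℕ} (hm : 1 ≤ m) {u : Fin n →₀ ℕ}
    (hu : u ∈ exponents (I ^ m)) : toPoint u ∈ (m : ℝ) • newtonPolyhedron I := by
  induction m, hm using Nat.le_induction generalizing u with
  | base =>
    rw [pow_one] at hu
    simpa using toPoint_mem_newtonPolyhedron hu
  | succ m hm ih =>
    rw [pow_succ] at hu
    obtain ⟨v, hv, w, hw, rfl⟩ := (hI.pow m).exists_add_of_mem_exponents_mul hI hu
    rw [toPoint_add, Nat.cast_add, (convex_newtonPolyhedron I).add_smul (by positivity)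
      (by positivity), Nat.cast_one, one_smul]
    exact Set.add_mem_add (ih hv) (toPoint_mem_newtonPolyhedron hw)

theorem IsMonomialIdeal.toPoint_mem_of_mem_exponents_idealClosure
    {I : Ideal (MvPolynomial (Fin n) k)} (hI : IsMonomialIdeal I) {u : Fin n →₀ ℕ}
    (hu : u ∈ exponents (idealClosure I)) : toPoint u ∈ newtonPolyhedron I := by
  classical
  obtain ⟨d, c, hd, hc, h⟩ : IsIntegralOver I (monomial u (1 : k)) := hu
  have h' := congrArg (coeff (d • u)) h
  rw [coeff_add, monomial_pow, one_pow, coeff_monomial, if_pos rfl, coeff_sum, coeff_zero] at h'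
  have hne : ∑ i ∈ Finset.Icc 1 d, coeff (d • u) (c i * monomial u (1 : k) ^ (d - i)) ≠ 0 := by
    intro h0
    rw [h0, add_zero] at h'
    exact one_ne_zero h'
  obtain ⟨i, hi, hne⟩ := Finset.exists_ne_zero_of_sum_ne_zero hne
  have hid := Finset.mem_Icc.1 hi
  have hdu : d • u = i • u + (d - i) • u := by
    rw [← add_nsmul]; congr 1; omega
  rw [monomial_pow, one_pow, hdu, coeff_mul_monomial, mul_one] at hne
  have hm := hI.toPoint_mem_of_mem_exponents_pow hid.1
    ((hI.pow i).mem_exponents (hc i hi) (mem_support_iff.2 hne))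
  have hi0 : (i : ℝ) ≠ 0 := by
    have := hid.1
    positivity
  rw [toPoint_nsmul] at hm
  exact (Set.smul_mem_smul_set_iff₀ hi0 _ _).1 hm

theorem isIntegralOver_of_pow_mem {R : Type*} [CommRing R] {J : Ideal R} {x : R} {m : ℕ}
    (hm : 0 < m) (h : x ^ m ∈ J ^ m) : IsIntegralOver J x := by
  refine ⟨m, fun i => if i = m then -x ^ m else 0, hm, ?_, ?_⟩
  · intro i _
    dsimp only
    split_ifs with hi
    · subst hi
      exact neg_mem h
    · exact zero_mem _
  · rw [Finset.sum_eq_single_of_mem m (Finset.mem_Icc.2 ⟨hm, le_rfl⟩)]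
    · simp
    · intro i _ hi
      simp [hi]

theorem sum_nsmul_mem_exponents_pow {I : Ideal (MvPolynomial (Fin n) k)} {ι : Type*}
    (s : Finset ι) {g : ι → (Fin n →₀ ℕ)} (hg : ∀ i, g i ∈ exponents I) (e : ι → ℕ) :
    ∑ i ∈ s, e i • g i ∈ exponents (I ^ ∑ i ∈ s, e i) := by
  classical
  induction s using Finset.induction_on with
  | empty =>
    rw [Finset.sum_empty, Finset.sum_empty, pow_zero, Ideal.one_eq_top]
    exact (Submodule.mem_top : monomial 0 (1 : k) ∈ (⊤ : Ideal (MvPolynomial (Fin n) k)))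
  | insert a s ha ih =>
    rw [Finset.sum_insert ha, Finset.sum_insert ha, pow_add]
    exact add_mem_exponents_mul (nsmul_mem_exponents_pow (hg a) _) ih

/-- A lattice point above a point of `q` times the Newton polyhedron of `I` is the exponent of a
monomial integral over `I ^ q`. -/
theorem mem_exponents_idealClosure_pow {I : Ideal (MvPolynomial (Fin n) k)} {ι : Type*}
    [Fintype ι] {g : ι → (Fin n →₀ ℕ)} (hg : ∀ i, g i ∈ exponents I) {w : ι → ℝ}
    (hw : ∀ i, 0 ≤ w i) (hw1 : ∑ i, w i = 1) {q : ℕ} {u : Fin n →₀ ℕ}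
    (hu : ∀ l, (q : ℝ) * ∑ i, w i * (g i l : ℝ) ≤ u l) :
    u ∈ exponents (idealClosure (I ^ q)) := by
  let e : ℕ → ι → ℕ := fun m i => ⌊(m : ℝ) * q * w i⌋₊
  have he_le : ∀ m i, (e m i : ℝ) ≤ m * q * w i := fun m i =>
    Nat.floor_le (mul_nonneg (by positivity) (hw i))
  have he_mono : ∀ m m' i, m ≤ m' → e m i ≤ e m' i := fun m m' i h =>
    Nat.floor_le_floor (by gcongr; exact hw i)
  have hsum_le : ∀ m, ∑ i, e m i ≤ m * q := by
    intro m
    have : ((∑ i, e m i : ℕ) : ℝ) ≤ ((m * q : ℕ) : ℝ) := by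
      push_cast
      calc ∑ i, (e m i : ℝ) ≤ ∑ i, (m : ℝ) * q * w i := Finset.sum_le_sum fun i _ => he_le m i
        _ = m * q := by rw [← Finset.mul_sum, hw1, mul_one]
    exact_mod_cast this
  have hle_sum : ∀ m, m * q ≤ ∑ i, e m i + Fintype.card ι := by
    intro m
    have : ((m * q : ℕ) : ℝ) ≤ ((∑ i, e m i + Fintype.card ι : ℕ) : ℝ) := by
      push_cast
      calc (m : ℝ) * q = ∑ i, (m : ℝ) * q * w i := by rw [← Finset.mul_sum, hw1, mul_one]
        _ ≤ ∑ i, ((e m i : ℝ) + 1) := Finset.sum_le_sum fun i _ => (Nat.lt_floor_add_one _).le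
        _ = _ := by simp [Finset.sum_add_distrib]
    exact_mod_cast this
  have hslack : ∀ m l, ∑ i, e m i * g i l ≤ m * u l := by
    intro m l
    have : ((∑ i, e m i * g i l : ℕ) : ℝ) ≤ ((m * u l : ℕ) : ℝ) := by
      push_cast
      calc ∑ i, (e m i : ℝ) * g i l ≤ ∑ i, (m : ℝ) * q * w i * g i l :=
            Finset.sum_le_sum fun i _ => by gcongr; exact he_le m i
        _ = m * (q * ∑ i, w i * (g i l : ℝ)) := by
            simp_rw [Finset.mul_sum]; exact Finset.sum_congr rfl fun i _ => by ring
        _ ≤ m * u l := by gcongr; exact hu l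
    exact_mod_cast this
  obtain ⟨m, m', hlt, hd, hd', hs⟩ := wellQuasiOrdered_le (α := ℕ × ℕ × (Fin n → ℕ))
    fun m => (m * q - ∑ i, e m i, Fintype.card ι - (m * q - ∑ i, e m i),
      fun l => m * u l - ∑ i, e m i * g i l)
  dsimp only at hd hd' hs
  have hmm : m * q ≤ m' * q := by gcongr
  have hcount : ∑ i, (e m' i - e m i) = q * (m' - m) := by
    rw [Finset.sum_tsub_distrib _ fun i _ => he_mono m m' i hlt.le, mul_comm, Nat.sub_mul]
    have h1 := hsum_le m
    have h2 := hsum_le m'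
    have h3 := hle_sum m
    have h4 := hle_sum m'
    omega
  have hle : ∑ i, (e m' i - e m i) • g i ≤ (m' - m) • u := by
    intro l
    have h1 := hs l
    dsimp only at h1
    have h2 := hslack m l
    have h3 := hslack m' l
    have h4 : m * u l ≤ m' * u l := by gcongr
    have h5 : ∑ i, e m i * g i l ≤ ∑ i, e m' i * g i l :=
      Finset.sum_le_sum fun i _ => Nat.mul_le_mul_right _ (he_mono m m' i hlt.le)
    simp only [Finsupp.coe_finsetSum, Finset.sum_apply, Finsupp.smul_apply, smul_eq_mul,
      Nat.sub_mul]
    rw [Finset.sum_tsub_distrib _ fun i _ => Nat.mul_le_mul_right _ (he_mono m m' i hlt.le)]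
    omega
  have hmem := mem_exponents_of_le
    (sum_nsmul_mem_exponents_pow Finset.univ hg (fun i => e m' i - e m i)) hle
  rw [hcount, pow_mul] at hmem
  refine isIntegralOver_of_pow_mem (m := m' - m) (by omega) ?_
  rw [monomial_pow, one_pow]
  exact hmem

end Exponents

section Noetherian

open Polynomial in
/-- If the Rees algebra is Noetherian, each ideal of the family is generated by products with a
factor of bounded positive index. -/
theorem exists_bound_of_isNoetherianRing {R : Type*} [CommRing R] (b : GradedFamily R)
    (hN : IsNoetherianRing (reesAlg b)) :
    ∃ D : ℕ, ∀ i, 1 ≤ i → ∀ T : Ideal R,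
      (∀ j, 1 ≤ j → j ≤ D → j ≤ i → b.ideal j * b.ideal (i - j) ≤ T) → b.ideal i ≤ T := by
  let J : Ideal (reesAlg b) :=
    RingHom.ker ((Polynomial.constantCoeff (R := R)).comp (reesAlg b).val.toRingHom)
  obtain ⟨S, hS⟩ := IsNoetherian.noetherian J
  refine ⟨S.sup fun s => (s : R[X]).natDegree, fun i hi T hT f hf => ?_⟩
  let x : reesAlg b := ⟨Polynomial.monomial i f, fun l => by
    rw [Polynomial.coeff_monomial]
    split_ifs with h
    · exact h ▸ hf
    · exact zero_mem _⟩
  have hxJ : x ∈ J := by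
    change (Polynomial.monomial i f).coeff 0 = 0
    rw [Polynomial.coeff_monomial, if_neg (by omega)]
  rw [← hS, Submodule.mem_span_finset'] at hxJ
  obtain ⟨c, hc⟩ := hxJ
  have hc' : f = (∑ s : S, ((c s : R[X]) * ((s : reesAlg b) : R[X]))).coeff i := by
    have h := congrArg (fun y : reesAlg b => (y : R[X]).coeff i) hc
    simpa [x, smul_eq_mul] using h.symm
  rw [hc', Polynomial.finsetSum_coeff]
  refine sum_mem fun s _ => ?_
  rw [Polynomial.coeff_mul]
  refine sum_mem ?_
  rintro ⟨p, q⟩ hpq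
  rw [Finset.HasAntidiagonal.mem_antidiagonal] at hpq
  dsimp only at hpq ⊢
  by_cases h0 : ((s : reesAlg b) : R[X]).coeff q = 0
  · rw [h0, mul_zero]; exact zero_mem _
  have hsJ : (s : reesAlg b) ∈ J := hS ▸ Submodule.subset_span s.2
  have hq0 : q ≠ 0 := by
    rintro rfl
    exact h0 hsJ
  have hqD : q ≤ S.sup fun s => (s : R[X]).natDegree :=
    (Polynomial.le_natDegree_of_ne_zero h0).trans
      (Finset.le_sup (f := fun s : reesAlg b => (s : R[X]).natDegree) s.2)
  rw [mul_comm]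
  refine hT q (by omega) hqD (by omega) ?_
  refine Ideal.mul_mem_mul ((s : reesAlg b).2 q) ?_
  have : i - q = p := by omega
  rw [this]
  exact (c s).2 p

end Noetherian

section Bodies

variable {k : Type*} [Field k] {n : ℕ}

theorem GradedFamily.pow_le {R : Type*} [CommRing R] (a : GradedFamily R) (m t : ℕ) :
    a.ideal m ^ t ≤ a.ideal (m * t) := by
  induction t with
  | zero => simp [a.ideal_zero]
  | succ t ih =>
    rw [pow_succ, Nat.mul_succ]
    exact (Ideal.mul_mono_left ih).trans (a.mul_le_add _ _)

theorem GradedFamily.nsmul_mem_exponents (a : GradedFamily (MvPolynomial (Fin n) k)) {m : ℕ}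
    {u : Fin n →₀ ℕ} (hu : u ∈ exponents (a.ideal m)) (t : ℕ) :
    t • u ∈ exponents (a.ideal (m * t)) :=
  a.pow_le m t (nsmul_mem_exponents_pow hu t)

theorem GradedFamily.smul_newtonPolyhedron_subset (a : GradedFamily (MvPolynomial (Fin n) k))
    {m t : ℕ} (ht : 1 ≤ t) :
    (1 / (m : ℝ)) • newtonPolyhedron (a.ideal m) ⊆
      (1 / ((m * t : ℕ) : ℝ)) • newtonPolyhedron (a.ideal (m * t)) := by
  refine GradedResurgence.smul_newtonPolyhedron_subset
    ((convex_newtonPolyhedron _).smul _) fun u hu => ?_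
  refine ⟨toPoint (t • u), toPoint_mem_newtonPolyhedron (a.nsmul_mem_exponents hu t), ?_⟩
  have ht0 : (t : ℝ) ≠ 0 := by positivity
  dsimp only
  rw [toPoint_nsmul, smul_smul]
  congr 1
  push_cast
  rw [one_div, one_div, mul_inv, mul_assoc, inv_mul_cancel₀ ht0, mul_one]

theorem isClosed_newtonOkounkovBody (a : GradedFamily (MvPolynomial (Fin n) k)) :
    IsClosed (newtonOkounkovBody a) := isClosed_closure

theorem convex_newtonOkounkovBody (a : GradedFamily (MvPolynomial (Fin n) k)) :
    Convex ℝ (newtonOkounkovBody a) := by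
  refine Convex.closure ?_
  rw [← Set.iUnion_subtype (fun m : ℕ => 1 ≤ m)
    fun m => (1 / ((m : ℕ) : ℝ)) • newtonPolyhedron (a.ideal m)]
  refine Directed.convex_iUnion ?_ fun m => (convex_newtonPolyhedron _).smul _
  rintro ⟨p, hp⟩ ⟨q, hq⟩
  refine ⟨⟨p * q, Nat.mul_pos hp hq⟩, a.smul_newtonPolyhedron_subset hq, ?_⟩
  dsimp only
  rw [mul_comm p q]
  exact a.smul_newtonPolyhedron_subset hp

theorem smul_toPoint_mem_newtonOkounkovBody (a : GradedFamily (MvPolynomial (Fin n) k)) {m : ℕ}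
    (hm : 1 ≤ m) {u : Fin n →₀ ℕ} (hu : u ∈ exponents (a.ideal m)) :
    (1 / (m : ℝ)) • toPoint u ∈ newtonOkounkovBody a :=
  subset_closure (Set.mem_biUnion (x := m) hm
    (Set.smul_mem_smul_set (toPoint_mem_newtonPolyhedron hu)))

theorem newtonOkounkovBody_subset (a : GradedFamily (MvPolynomial (Fin n) k))
    {C : Set (Fin n → ℝ)} (hC : Convex ℝ C) (hC' : IsClosed C)
    (h : ∀ m, 1 ≤ m → ∀ u ∈ exponents (a.ideal m), (1 / (m : ℝ)) • toPoint u ∈ C) :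
    newtonOkounkovBody a ⊆ C := by
  refine closure_minimal (Set.iUnion₂_subset fun m hm => ?_) hC'
  exact smul_newtonPolyhedron_subset hC (h m hm)

theorem nonneg_of_mem_newtonOkounkovBody (a : GradedFamily (MvPolynomial (Fin n) k))
    {v : Fin n → ℝ} (hv : v ∈ newtonOkounkovBody a) : 0 ≤ v := by
  refine newtonOkounkovBody_subset a (convex_Ici (𝕜 := ℝ) (0 : Fin n → ℝ)) isClosed_Ici
    (fun m _ u _ l => ?_) hv
  simp only [toPoint, Pi.smul_apply, smul_eq_mul, Pi.zero_apply]
  positivity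

/-- The asymptotic resurgence is at least every noncontainment scalar. -/
theorem sSup_noncontainmentScalars_le (a b : GradedFamily (MvPolynomial (Fin n) k))
    (hb : ∀ i : ℕ, 1 ≤ i → IsMonomialIdeal (b.ideal i)) :
    sSup (Real.toEReal '' noncontainmentScalars (newtonOkounkovBody a) (newtonOkounkovBody b)) ≤
      asympResurgence a.ideal (fun i => idealClosure (b.ideal i)) := by
  refine sSup_le ?_
  rintro _ ⟨c, ⟨hc, hnot⟩, rfl⟩
  obtain ⟨m, hm, u, hu, hcu⟩ : ∃ m, 1 ≤ m ∧ ∃ u ∈ exponents (a.ideal m),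
      c • ((1 / (m : ℝ)) • toPoint u) ∉ newtonOkounkovBody b := by
    by_contra! hcon
    refine hnot ?_
    rw [Set.smul_set_subset_iff]
    have hpre := newtonOkounkovBody_subset a
      ((convex_newtonOkounkovBody b).is_linear_preimage (f := fun x => c • x)
        (IsLinearMap.isLinearMap_smul c))
      ((isClosed_newtonOkounkovBody b).preimage (continuous_const_smul c)) hcon
    exact fun x hx => hpre hx
  have hopen : IsOpen {x : ℝ | x • ((1 / (m : ℝ)) • toPoint u) ∉ newtonOkounkovBody b} :=
    (isClosed_newtonOkounkovBody b).isOpen_compl.preimage (by fun_prop)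
  obtain ⟨ε, hε, hball⟩ := Metric.isOpen_iff.1 hopen c hcu
  obtain ⟨x, hcx, hxε⟩ := exists_rat_btwn (show c < c + ε by linarith)
  have hx : (x : ℝ) • ((1 / (m : ℝ)) • toPoint u) ∉ newtonOkounkovBody b := by
    refine hball ?_
    rw [Metric.mem_ball, Real.dist_eq, abs_lt]
    constructor <;> linarith
  have hx0 : 0 < x := by exact_mod_cast hc.trans hcx
  have hnum : (1 : ℕ) ≤ x.num.toNat := by
    have := Rat.num_pos.2 hx0
    omega
  have hxeq : (x : ℝ) = (x.num.toNat : ℝ) / x.den := by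
    conv_lhs => rw [← Rat.num_div_den x]
    have : ((x.num.toNat : ℕ) : ℤ) = x.num := Int.toNat_of_nonneg (Rat.num_pos.2 hx0).le
    push_cast
    congr 1
    exact_mod_cast this.symm
  have hden : (x.den : ℝ) ≠ 0 := by exact_mod_cast x.den_nz
  have hm0 : (m : ℝ) ≠ 0 := by positivity
  refine le_trans (EReal.coe_le_coe hcx.le) (le_sSup ⟨m * x.num.toNat, m * x.den,
    Nat.mul_pos hm hnum, Nat.mul_pos hm x.den_pos, ?_, ?_⟩)
  · filter_upwards [Filter.eventually_ge_atTop 1] with t ht hle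
    have h1 : (x.num.toNat * t) • u ∈ exponents (a.ideal (m * x.num.toNat * t)) := by
      rw [mul_assoc]
      exact a.nsmul_mem_exponents hu _
    have hpos : 1 ≤ m * x.den * t := Nat.mul_pos (Nat.mul_pos hm x.den_pos) ht
    have h2 := (hb _ hpos).toPoint_mem_of_mem_exponents_idealClosure (hle h1)
    have h3 : (1 / ((m * x.den * t : ℕ) : ℝ)) • toPoint ((x.num.toNat * t) • u) ∈
        newtonOkounkovBody b :=
      subset_closure (Set.mem_biUnion (x := m * x.den * t) hpos (Set.smul_mem_smul_set h2))
    apply hx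
    convert h3 using 1
    rw [toPoint_nsmul, smul_smul, smul_smul, hxeq]
    congr 1
    have ht0 : (t : ℝ) ≠ 0 := by positivity
    push_cast
    field_simp
  · rw [hxeq]
    congr 1
    push_cast
    field_simp

/-- For a Noetherian Rees algebra, the Newton–Okounkov body is governed by one Veronese piece. -/
theorem exists_veronese_of_isNoetherianRing (b : GradedFamily (MvPolynomial (Fin n) k))
    (hb : ∀ i : ℕ, 1 ≤ i → IsMonomialIdeal (b.ideal i)) (hN : IsNoetherianRing (reesAlg b)) :
    ∃ N : ℕ, 1 ≤ N ∧ ∀ i, 1 ≤ i → ∀ u ∈ exponents (b.ideal i),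
      (1 / (i : ℝ)) • toPoint u ∈ (1 / (N : ℝ)) • newtonPolyhedron (b.ideal N) := by
  obtain ⟨D, hD⟩ := exists_bound_of_isNoetherianRing b hN
  refine ⟨D.factorial, D.factorial_pos, ?_⟩
  set C := (1 / (D.factorial : ℝ)) • newtonPolyhedron (b.ideal D.factorial) with hCdef
  have hC : Convex ℝ C := (convex_newtonPolyhedron _).smul _
  have hmon : ∀ i, IsMonomialIdeal (b.ideal i) := fun i => by
    rcases Nat.eq_zero_or_pos i with rfl | hi
    · rw [b.ideal_zero]; exact isMonomialIdeal_top
    · exact hb i hi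
  have hsmall : ∀ j, 1 ≤ j → j ≤ D → ∀ v ∈ exponents (b.ideal j),
      (1 / (j : ℝ)) • toPoint v ∈ C := by
    intro j hj hjD v hv
    obtain ⟨t, ht⟩ := Nat.dvd_factorial hj hjD
    have ht1 : 1 ≤ t := by
      have := D.factorial_pos
      rcases Nat.eq_zero_or_pos t with rfl | h
      · omega
      · exact h
    have := b.smul_newtonPolyhedron_subset (m := j) ht1
      (Set.smul_mem_smul_set (toPoint_mem_newtonPolyhedron hv))
    rw [← ht] at this
    exact this
  intro i
  induction i using Nat.strong_induction_on with
  | _ i ih =>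
  intro hi u hu
  let S : Set (Fin n →₀ ℕ) := {u | ∃ j, 1 ≤ j ∧ j ≤ D ∧ j ≤ i ∧
    u ∈ exponents (b.ideal j) + exponents (b.ideal (i - j))}
  have hle : b.ideal i ≤ Ideal.span ((fun v => monomial v (1 : k)) '' S) := by
    refine hD i hi _ fun j hj hjD hji => ((hmon j).mul_le_span (hmon _)).trans ?_
    exact Ideal.span_mono (Set.image_mono fun v hv => ⟨j, hj, hjD, hji, hv⟩)
  obtain ⟨_, ⟨j, hj, hjD, hji, v, hv, w, hw, rfl⟩, hsu⟩ := mem_exponents_span.1 (hle hu)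
  obtain ⟨z, rfl⟩ := exists_add_of_le hsu
  rcases hji.eq_or_lt with rfl | hlt
  · refine hsmall j hj hjD _ ?_
    rw [add_assoc]
    exact add_mem_exponents hv _
  · have h1 := hsmall j hj hjD v hv
    have h2 := ih (i - j) (by omega) (by omega) _ (add_mem_exponents hw z)
    have hj0 : (0 : ℝ) < j := by positivity
    have hi0 : (0 : ℝ) < i := by positivity
    have hij : ((i - j : ℕ) : ℝ) = i - j := by push_cast [hlt.le]; ring
    have hij0 : (0 : ℝ) < i - j := by rw [← hij]; exact_mod_cast (by omega : 0 < i - j)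
    have h3 := hC h1 h2 (a := (j : ℝ) / i) (b := ((i : ℝ) - j) / i) (by positivity)
      (by positivity) (by field_simp; ring)
    convert h3 using 1
    change _ • toPoint (v + w + z) = _
    rw [add_assoc, toPoint_add, hij, smul_smul, smul_smul, smul_add]
    congr 2 <;> field_simp

/-- For a Noetherian Rees algebra, the asymptotic resurgence is at most the supremum of the
noncontainment scalars. -/
theorem asympResurgence_le (a b : GradedFamily (MvPolynomial (Fin n) k))
    (ha : ∀ i : ℕ, 1 ≤ i → IsMonomialIdeal (a.ideal i))
    (hb : ∀ i : ℕ, 1 ≤ i → IsMonomialIdeal (b.ideal i)) (hN : IsNoetherianRing (reesAlg b)) :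
    asympResurgence a.ideal (fun i => idealClosure (b.ideal i)) ≤
      sSup (Real.toEReal ''
        noncontainmentScalars (newtonOkounkovBody a) (newtonOkounkovBody b)) := by
  obtain ⟨N, hN1, hver⟩ := exists_veronese_of_isNoetherianRing b hb hN
  have hN0 : (0 : ℝ) < N := by positivity
  obtain ⟨G, hG, hGmin⟩ := (hb N hN1).exists_finset
  let P : Set (Fin n → ℝ) := convexHull ℝ (toPoint '' (G : Set (Fin n →₀ ℕ))) + Set.Ici 0
  have hPconv : Convex ℝ P := (convex_convexHull ℝ _).add (convex_Ici (𝕜 := ℝ) (0 : Fin n → ℝ))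
  have hPclosed : IsClosed P :=
    isClosed_Ici.add_left_of_isCompact
      ((G.finite_toSet.image toPoint).isCompact_convexHull (𝕜 := ℝ))
  have hsub : newtonOkounkovBody b ⊆ (1 / (N : ℝ)) • P := by
    refine newtonOkounkovBody_subset b (hPconv.smul _) (hPclosed.smul_of_ne_zero
      (one_div_ne_zero hN0.ne'))
      fun i hi u hu => ?_
    refine Set.smul_set_mono ?_ (hver i hi u hu)
    rw [newtonPolyhedron_eq]
    refine convexHull_min ?_ hPconv
    rintro _ ⟨v, hv, rfl⟩
    obtain ⟨g, hg, hgv⟩ := hGmin v hv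
    obtain ⟨z, rfl⟩ := exists_add_of_le hgv
    rw [toPoint_add]
    exact Set.add_mem_add (subset_convexHull ℝ _ ⟨g, hg, rfl⟩) fun l => Nat.cast_nonneg (z l)
  refine sSup_le ?_
  rintro _ ⟨s, r, hs, hr, hev, rfl⟩
  have hs0 : (0 : ℝ) < s := by positivity
  have hr0 : (0 : ℝ) < r := by positivity
  refine le_sSup ⟨_, ⟨by positivity, fun hcont => ?_⟩, rfl⟩
  obtain ⟨T, hT⟩ := Filter.eventually_atTop.1 hev
  refine hT (N * (T + 1)) (by nlinarith) ?_
  have ht1 : 1 ≤ N * (T + 1) := Nat.mul_pos hN1 (by omega)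
  refine le_of_exponents_subset (ha _ (Nat.mul_pos hs ht1)) fun u hu => ?_
  have h1 := smul_toPoint_mem_newtonOkounkovBody a (Nat.mul_pos hs ht1) hu
  obtain ⟨p, hp, hpu⟩ := hsub (hcont (Set.smul_mem_smul_set h1))
  obtain ⟨y, hy, z, hz, rfl⟩ := hp
  obtain ⟨ι, _, w, g, hw, hw1, hg, rfl⟩ := mem_convexHull_iff_exists_fintype.1 hy
  choose g' hg' hgg' using hg
  have hcl : u ∈ exponents (idealClosure (b.ideal N ^ (r * (T + 1)))) := by
    refine mem_exponents_idealClosure_pow (fun i => hG _ (hg' i)) hw hw1 fun l => ?_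
    have hl := congrFun hpu l
    have hzl : 0 ≤ z l := hz l
    have hsum : (∑ i, w i • g i) l = ∑ i, w i * (g' i l : ℝ) := by
      simp [← hgg', toPoint]
    simp only [Pi.smul_apply, Pi.add_apply, smul_eq_mul, hsum, toPoint] at hl
    push_cast at hl ⊢
    have hT0 : (0 : ℝ) < T + 1 := by positivity
    have hu' : (u l : ℝ) = r * (T + 1) * (∑ i, w i * (g' i l : ℝ) + z l) := by
      field_simp at hl
      linarith
    rw [hu', mul_add]
    have : 0 ≤ (r : ℝ) * (T + 1) * z l := by positivity
    linarith
  have hle : b.ideal N ^ (r * (T + 1)) ≤ b.ideal (r * (N * (T + 1))) := by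
    have := b.pow_le N (r * (T + 1))
    rwa [mul_left_comm] at this
  obtain ⟨d, c, hd, hc, h⟩ := hcl
  exact ⟨d, c, hd, fun i hi => Ideal.pow_right_mono hle i (hc i hi), h⟩

end Bodies

section Polar

theorem sSup_coe_eq_extRecip {T S : Set ℝ} (hT0 : ∀ t ∈ T, 0 ≤ t) (hT : T.Nonempty)
    (hS : ∀ c, c ∈ S ↔ 0 < c ∧ ∃ t ∈ T, c * t < 1) :
    sSup (Real.toEReal '' S) = extRecip (sInf (Real.toEReal '' T)) := by
  have hbdd : BddBelow T := ⟨0, hT0⟩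
  have hinf : sInf (Real.toEReal '' T) = ((sInf T : ℝ) : EReal) := by
    refine IsGLB.sInf_eq ⟨?_, fun x hx => ?_⟩
    · rintro _ ⟨t, ht, rfl⟩
      exact EReal.coe_le_coe (csInf_le hbdd ht)
    · by_contra! hlt
      obtain ⟨y, hy, hyx⟩ := EReal.lt_iff_exists_real_btwn.1 hlt
      obtain ⟨t, ht, hty⟩ := (csInf_lt_iff hbdd hT).1 (EReal.coe_lt_coe_iff.1 hy)
      exact absurd ((hx ⟨t, ht, rfl⟩).trans_lt (EReal.coe_lt_coe hty)) hyx.not_gt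
  have hi0 : 0 ≤ sInf T := le_csInf hT hT0
  have hSi : ∀ c, c ∈ S ↔ 0 < c ∧ sInf T < c⁻¹ := by
    intro c
    rw [hS, csInf_lt_iff hbdd hT]
    refine and_congr_right fun hc => exists_congr fun t => and_congr_right fun _ => ?_
    rw [← lt_inv_mul_iff₀ hc, mul_one]
  rw [hinf, extRecip]
  rcases hi0.eq_or_lt with h | h
  · rw [← h, EReal.coe_zero, if_pos rfl]
    have : S = Set.Ioi 0 := by
      ext c
      rw [hSi, ← h, Set.mem_Ioi, inv_pos, and_self]
    rw [this, EReal.image_coe_Ioi]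
    exact csSup_Ioo (EReal.coe_lt_top 0)
  · rw [if_neg (by exact_mod_cast h.ne'), ← EReal.coe_inv]
    have : S = Set.Ioo 0 (sInf T)⁻¹ := by
      ext c
      rw [hSi, Set.mem_Ioo]
      exact and_congr_right fun hc => lt_inv_comm₀ h hc
    rw [this, EReal.image_coe_Ioo]
    exact csSup_Ioo (EReal.coe_lt_coe (inv_pos.2 h))

variable {k : Type*} [Field k] {n : ℕ}

/-- A linear functional bounded below on a nonempty Newton–Okounkov body is nonnegative. -/
theorem nonneg_of_le_dotProduct (b : GradedFamily (MvPolynomial (Fin n) k))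
    (hb : ∃ i, 1 ≤ i ∧ (exponents (b.ideal i)).Nonempty) {y : Fin n → ℝ} {c : ℝ}
    (h : ∀ v ∈ newtonOkounkovBody b, c ≤ y ⬝ᵥ v) : 0 ≤ y := by
  obtain ⟨i, hi, u, hu⟩ := hb
  intro l
  by_contra! hneg
  have hi0 : (0 : ℝ) < i := by positivity
  obtain ⟨m, hm⟩ := exists_nat_gt ((y ⬝ᵥ toPoint u - i * c) / -(y l))
  have hmem := h _ (smul_toPoint_mem_newtonOkounkovBody b hi
    (add_mem_exponents hu (Finsupp.single l m)))
  have hsingle : toPoint (Finsupp.single l m) = Pi.single l (m : ℝ) := by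
    ext j
    by_cases hj : j = l
    · subst hj; simp [toPoint]
    · simp [toPoint, hj]
  rw [dotProduct_smul, toPoint_add, dotProduct_add, hsingle, dotProduct_single, smul_eq_mul,
    one_div, le_inv_mul_iff₀ hi0] at hmem
  rw [div_lt_iff₀ (by simpa using hneg)] at hm
  linarith

/-- A nonnegative point outside a nonempty Newton–Okounkov body is detected by the polar set. -/
theorem exists_polarSet_dotProduct_lt (b : GradedFamily (MvPolynomial (Fin n) k))
    (hb : ∃ i, 1 ≤ i ∧ (exponents (b.ideal i)).Nonempty) {x : Fin n → ℝ} (hx0 : 0 ≤ x)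
    (hx : x ∉ newtonOkounkovBody b) :
    ∃ y ∈ polarSet (newtonOkounkovBody b), x ⬝ᵥ y < 1 := by
  obtain ⟨f, c, hfx, hf⟩ := geometric_hahn_banach_point_closed (convex_newtonOkounkovBody b)
    (isClosed_newtonOkounkovBody b) hx
  let y : Fin n → ℝ := fun l => f (Pi.single l 1)
  have hfy : ∀ v, f v = y ⬝ᵥ v := by
    intro v
    conv_lhs => rw [pi_eq_sum_univ' v]
    simp [y, dotProduct, mul_comm]
  have hy0 : 0 ≤ y := nonneg_of_le_dotProduct b hb (c := c) fun v hv => hfy v ▸ (hf v hv).le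
  have hc : 0 < c := by
    refine lt_of_le_of_lt ?_ hfx
    rw [hfy]
    exact dotProduct_nonneg_of_nonneg hy0 hx0
  refine ⟨c⁻¹ • y, fun v hv => ?_, ?_⟩
  · rw [smul_dotProduct, smul_eq_mul, ← hfy, le_inv_mul_iff₀ hc, mul_one]
    exact (hf v hv).le
  · rw [dotProduct_smul, smul_eq_mul, dotProduct_comm, ← hfy, inv_mul_lt_iff₀ hc, mul_one]
    exact hfx

theorem sSup_noncontainmentScalars_eq (a b : GradedFamily (MvPolynomial (Fin n) k))
    (hb : ∃ i, 1 ≤ i ∧ (exponents (b.ideal i)).Nonempty)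
    (hne : (noncontainmentScalars (newtonOkounkovBody a) (newtonOkounkovBody b)).Nonempty) :
    sSup (Real.toEReal '' noncontainmentScalars (newtonOkounkovBody a) (newtonOkounkovBody b)) =
      extRecip (infDot (newtonOkounkovBody a) (polarSet (newtonOkounkovBody b))) := by
  let T : Set ℝ := {t | ∃ x ∈ newtonOkounkovBody a, ∃ y ∈ polarSet (newtonOkounkovBody b),
    t = x ⬝ᵥ y}
  have hinf : infDot (newtonOkounkovBody a) (polarSet (newtonOkounkovBody b)) =
      sInf (Real.toEReal '' T) := by
    unfold infDot
    congr 1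
    ext e
    constructor
    · rintro ⟨x, hx, y, hy, rfl⟩
      exact ⟨_, ⟨x, hx, y, hy, rfl⟩, rfl⟩
    · rintro ⟨_, ⟨x, hx, y, hy, rfl⟩, rfl⟩
      exact ⟨x, hx, y, hy, rfl⟩
  have hS : ∀ c, c ∈ noncontainmentScalars (newtonOkounkovBody a) (newtonOkounkovBody b) ↔
      0 < c ∧ ∃ t ∈ T, c * t < 1 := by
    intro c
    refine and_congr_right fun hc => ?_
    rw [Set.smul_set_subset_iff]
    constructor
    · intro h
      push Not at h
      obtain ⟨x, hx, hcx⟩ := h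
      obtain ⟨y, hy, hxy⟩ := exists_polarSet_dotProduct_lt b hb
        (smul_nonneg hc.le (nonneg_of_mem_newtonOkounkovBody a hx)) hcx
      refine ⟨_, ⟨x, hx, y, hy, rfl⟩, ?_⟩
      rwa [smul_dotProduct, smul_eq_mul] at hxy
    · rintro ⟨_, ⟨x, hx, y, hy, rfl⟩, hlt⟩ hcon
      have h := hy _ (hcon hx)
      rw [dotProduct_smul, smul_eq_mul, dotProduct_comm] at h
      linarith
  rw [hinf]
  refine sSup_coe_eq_extRecip ?_ ?_ hS
  · rintro _ ⟨x, hx, y, hy, rfl⟩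
    exact dotProduct_nonneg_of_nonneg (nonneg_of_mem_newtonOkounkovBody a hx)
      (nonneg_of_le_dotProduct b hb hy)
  · obtain ⟨c, hc⟩ := hne
    obtain ⟨-, t, ht, -⟩ := (hS c).1 hc
    exact ⟨t, ht⟩

end Polar

end GradedResurgence

theorem theorem2p7 {k : Type*} [Field k] {n : ℕ}
    (a b : GradedFamily (MvPolynomial (Fin n) k))
    (ha : ∀ i : ℕ, 1 ≤ i → IsMonomialIdeal (a.ideal i))
    (hb : ∀ i : ℕ, 1 ≤ i → IsMonomialIdeal (b.ideal i)) :
    (IsNoetherianRing (reesAlg b) →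
      asympResurgence a.ideal (fun i => idealClosure (b.ideal i)) =
        sSup (Real.toEReal ''
          noncontainmentScalars (newtonOkounkovBody a) (newtonOkounkovBody b))) ∧
    ((∃ i : ℕ, 1 ≤ i ∧ b.ideal i ≠ ⊥) →
      (noncontainmentScalars (newtonOkounkovBody a) (newtonOkounkovBody b)).Nonempty →
      sSup (Real.toEReal ''
          noncontainmentScalars (newtonOkounkovBody a) (newtonOkounkovBody b)) =
        extRecip (infDot (newtonOkounkovBody a) (polarSet (newtonOkounkovBody b)))) := by
  refine ⟨fun hN => le_antisymm (asympResurgence_le a b ha hb hN)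
    (sSup_noncontainmentScalars_le a b hb), ?_⟩
  rintro ⟨i, hi, hne⟩ hS
  refine sSup_noncontainmentScalars_eq a b ⟨i, hi, ?_⟩ hS
  by_contra hempty
  refine hne (le_bot_iff.1 (le_of_exponents_subset (hb i hi) ?_))
  rw [Set.not_nonempty_iff_eq_empty.1 hempty]
  exact Set.empty_subset _
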